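/- Let $M$ be a closed (compact, without boundary) two-dimensional manifold with a finite triangulation $T$ whose simplices are determined by their vertex sets; $V$, $E$ and $E_+$ denote its sets of vertices, edges and directed edges. A function $\ell:E\to\mathbb R$ makes $(M,T,\ell)$ piecewise flat if each simplex of $T$ embeds as a nondegenerate Euclidean simplex with edge lengths $\ell_{ij}$. The curvature at a vertex $i$ is then $K_i=2\pi-\sum_{\{i,j,k\}}\gamma_{i,jk}$, where the sum runs over the triangles containing $i$ and $\gamma_{i,jk}$ is the angle at $i$ of the Euclidean triangle with edge lengths $\ell_{ij},\ell_{ik},\ell_{jk}$. A metric is a function $d:E_+\to\mathbb R$ such that $(M,T,\ell)$ is piecewise flat for $\ell_{ij}=d_{ij}+d_{ji}$, and $d_{ij}^2+d_{jk}^2+d_{ki}^2=d_{ji}^2+d_{ik}^2+d_{kj}^2$ for every triangle $\{i,j,k\}$. For $f\in\mathbb R^V$, let $d=\mathcal C[f]$ be given by one of the following conformal structures. 1. Fixed inversive distance: for a given $\eta:E\to\mathbb R$ with $\eta_{ij}\ge 0$ for all $\{i,j\}\in E$, $$d_{ij}=\frac{e^{f_i}\left(e^{f_i}+e^{f_j}\eta_{ij}\right)}{\sqrt{e^{2f_i}+e^{2f_j}+2e^{f_i}e^{f_j}\eta_{ij}}}.$$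 2. Perpendicular bisector: for a given $L:E\to\mathbb R$ such that $(M,T,L)$ is piecewise flat, $$d_{ij}=\tfrac12 e^{\frac12(f_i+f_j)}L_{ij}.$$ In each case let $U\subset\mathbb R^V$ be an open set such that $\mathcal C[f]$ is a metric for all $f\in U$. If $U$ is simply connected, then there is a function $F:U\to\mathbb R$ with $\partial F/\partial f_i=K_i$ on $U$ for every $i\in V$. Moreover, whether or not $U$ is simply connected, every function $F:U\to\mathbb R$ with $\partial F/\partial f_i=K_i$ on $U$ for every $i\in V$ is convex on every convex subset of $U$ (equivalently, along every line segment contained in $U$). -/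

import Mathlib

noncomputable section

namespace PiecewiseFlat

variable {V : Type*}

/-- The geometric realization `|T|` of a finite abstract simplicial complex, in barycentric
coordinates, with the topology of `V → ℝ`. -/
abbrev Realization [Fintype V] (T : AbstractSimplicialComplex V) : Type _ :=
  {x : V → ℝ // (∀ i, 0 ≤ x i) ∧ ∑ i, x i = 1 ∧ ∃ s ∈ T.faces, ∀ i, i ∈ s ↔ x i ≠ 0}

/-- A triangulation `T` of the space `M`: a homeomorphism `|T| ≃ M`. -/
abbrev Triangulates [Fintype V] (T : AbstractSimplicialComplex V)
    (M : Type*) [TopologicalSpace M] : Prop :=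
  Nonempty (Realization T ≃ₜ M)

open Classical in
/-- `{i, j}` is an edge of `T` (equivalently, `(i, j)` is a directed edge). -/
def IsEdge (T : AbstractSimplicialComplex V) (i j : V) : Prop :=
  i ≠ j ∧ {i, j} ∈ T.faces

open Classical in
/-- `{i, j, k}` is a triangle of `T`, with distinct vertices `i, j, k`. -/
def IsTriangle (T : AbstractSimplicialComplex V) (i j k : V) : Prop :=
  i ≠ j ∧ i ≠ k ∧ j ≠ k ∧ {i, j, k} ∈ T.faces

/-- `ℓ`, a function of the edges of `T` (its values elsewhere play no role), makes `T` piecewise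
flat: each simplex embeds in a Euclidean space as a nondegenerate simplex with edge lengths `ℓ`. -/
def IsPiecewiseFlat (T : AbstractSimplicialComplex V) (ℓ : Sym2 V → ℝ) : Prop :=
  ∀ s ∈ T.faces, ∃ (n : ℕ) (p : s → EuclideanSpace ℝ (Fin n)),
    AffineIndependent ℝ p ∧ ∀ i j : s, i ≠ j → dist (p i) (p j) = ℓ s(i.1, j.1)

/-- The edge lengths `ℓ i j = d i j + d j i` of a function `d` of the directed edges. -/
def len (d : V → V → ℝ) : Sym2 V → ℝ :=
  Sym2.lift ⟨fun i j => d i j + d j i, fun _ _ => add_comm _ _⟩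

/-- `d`, a function of the directed edges of `T` (its values elsewhere play no role), is a
piecewise flat metric on `T`; that is, `d ∈ 𝔪𝔢𝔱(M, T)`. -/
structure IsMetric (T : AbstractSimplicialComplex V) (d : V → V → ℝ) : Prop where
  piecewiseFlat : IsPiecewiseFlat T (len d)
  center : ∀ i j k, IsTriangle T i j k →
    d i j ^ 2 + d j k ^ 2 + d k i ^ 2 = d j i ^ 2 + d i k ^ 2 + d k j ^ 2

/-- The angle at `i` in the Euclidean triangle `{i, j, k}` with edge lengths `ℓ`, computed with
the law of cosines. -/
def angle (ℓ : Sym2 V → ℝ) (i j k : V) : ℝ :=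
  Real.arccos ((ℓ s(i, j) ^ 2 + ℓ s(i, k) ^ 2 - ℓ s(j, k) ^ 2) / (2 * ℓ s(i, j) * ℓ s(i, k)))

/-- `angle` is the angle at `i` in an embedded triangle with edge lengths `ℓ`. -/
theorem angle_eq {n : ℕ} (ℓ : Sym2 V → ℝ) (p : V → EuclideanSpace ℝ (Fin n)) (i j k : V)
    (hij : dist (p i) (p j) = ℓ s(i, j)) (hik : dist (p i) (p k) = ℓ s(i, k))
    (hjk : dist (p j) (p k) = ℓ s(j, k)) :
    angle ℓ i j k = EuclideanGeometry.angle (p j) (p i) (p k) := by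
  have h := real_inner_eq_norm_mul_self_add_norm_mul_self_sub_norm_sub_mul_self_div_two
    (p j - p i) (p k - p i)
  rw [sub_sub_sub_cancel_right] at h
  rw [dist_comm, dist_eq_norm] at hij hik
  rw [dist_eq_norm] at hjk
  simp only [EuclideanGeometry.angle, InnerProductGeometry.angle, angle, vsub_eq_sub, h, hij, hik,
    hjk]
  congr 1
  rw [div_div, mul_assoc]
  ring

open Classical in
/-- The curvature `K i = 2π - ∑ γ_{i,jk}`, the sum being over the triangles `{i, j, k}` of `T`
that contain `i`. Each of them occurs as `(j, k)` and as `(k, j)` in the double sum, whence the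
factor `1 / 2`. -/
def curvature [Fintype V] (T : AbstractSimplicialComplex V) (ℓ : Sym2 V → ℝ) (i : V) : ℝ :=
  2 * Real.pi - (1 / 2) * ∑ j, ∑ k, if IsTriangle T i j k then angle ℓ i j k else 0

/-- `F` is a curvature functional on `U` for a map `C` that sends a function `f` of the vertices
to a function `d = C f` of the directed edges: `∂F/∂f_i = K_i` on `U` for each vertex `i`. -/
def IsCurvatureFunctional [Fintype V] (T : AbstractSimplicialComplex V)
    (C : (V → ℝ) → V → V → ℝ) (U : Set (V → ℝ)) (F : (V → ℝ) → ℝ) : Prop :=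
  open Classical in
  ∀ f ∈ U, ∀ i, HasLineDerivAt ℝ F (curvature T (len (C f)) i) f (Pi.single i 1)

/-- The fixed inversive distance conformal structure with inversive distances `η`. -/
def fixedInversive (η : Sym2 V → ℝ) (f : V → ℝ) (i j : V) : ℝ :=
  Real.exp (f i) * (Real.exp (f i) + Real.exp (f j) * η s(i, j)) /
    √(Real.exp (2 * f i) + Real.exp (2 * f j) + 2 * Real.exp (f i) * Real.exp (f j) * η s(i, j))

/-- The perpendicular bisector conformal structure with base lengths `L`. -/
def perpBisector (L : Sym2 V → ℝ) (f : V → ℝ) (i j : V) : ℝ :=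
  1 / 2 * Real.exp ((f i + f j) / 2) * L s(i, j)

end PiecewiseFlat

end

section

/-! In both structures ∂ℓ_ij²/∂f_i = ℓ_ij² + p_i - p_j, where p_i = e^{2f_i} for fixed inversive
distance and p_i = 0 for perpendicular bisectors (`IsConformalOn`). The cosine law then gives
∂γ_i/∂f_j = ∂γ_j/∂f_i = `edgeWeight`: the signed distance from the power center of the triangle to
the edge ij, divided by ℓ_ij. A common shift of all f_i rescales the triangle, so it fixes the
angles. Hence the Jacobian of K is a symmetric weighted Laplacian, and ∑ K_i df_i is closed, so
exact when U is simply connected (`IsSimplyConnected.exists_primitive`).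

For convexity, the Laplacian splits over triangles. On one triangle it is a binary quadratic form
whose trace against the Gram matrix of two edges is twice the area, and whose determinant has the
sign of R² - |OP|², with R the circumradius, O the circumcenter and P the power center. Since p_i +
p_j ≤ ℓ_ij² (this is η ≥ 0 in the first structure), P lies in the circumdisk
(`power_center_mem_circumdisk`), and `quadratic_form_nonneg` applies. -/

open Set Filter Topology Metric

/-! ### Primitives of locally exact forms -/

/-- The real line with the discrete topology. -/
@[ext]
structure DiscreteReal where
  /-- The underlying real number. -/
  val : ℝ

instance : TopologicalSpace DiscreteReal := ⊥

instance : DiscreteTopology DiscreteReal := ⟨rfl⟩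

/-- Two primitives of the same form on a preconnected open set differ by a constant. -/
theorem sub_eq_sub_of_hasFDerivAt {E : Type*} [NormedAddCommGroup E] [NormedSpace ℝ E]
    {ω : E → E →L[ℝ] ℝ} {s : Set E} (hs : IsOpen s) (hc : IsPreconnected s) {g h : E → ℝ}
    (hg : ∀ y ∈ s, HasFDerivAt g (ω y) y) (hh : ∀ y ∈ s, HasFDerivAt h (ω y) y)
    {x y : E} (hx : x ∈ s) (hy : y ∈ s) : g x - h x = g y - h y := by
  have hd : ∀ z ∈ s, HasFDerivAt (fun z => g z - h z) (0 : E →L[ℝ] ℝ) z := fun z hz => by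
    have := (hg z hz).sub (hh z hz)
    rwa [sub_self] at this
  exact hs.is_const_of_fderiv_eq_zero hc
    (fun z hz => (hd z hz).differentiableAt.differentiableWithinAt)
    (fun z hz => (hd z hz).fderiv) hx hy

/-- The bundle of germs of primitives of a locally exact form. -/
def primitiveCore {E : Type*} [NormedAddCommGroup E] [NormedSpace ℝ E] {U : Set E}
    {ω : E → E →L[ℝ] ℝ} (r : U → ℝ) (hr : ∀ x, 0 < r x) (g : U → E → ℝ)
    (hg : ∀ x : U, ∀ y ∈ ball (x : E) (r x), HasFDerivAt (g x) (ω y) y) :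
    FiberBundleCore U U DiscreteReal where
  baseSet i := {x | (x : E) ∈ ball (i : E) (r i)}
  isOpen_baseSet i := isOpen_ball.preimage continuous_subtype_val
  indexAt := id
  mem_baseSet_at x := mem_ball_self (hr x)
  -- The coordinate `v` in chart `i` stands for the germ of `g i + v`.
  coordChange i j x v := ⟨v.val + (g i x - g j x)⟩
  coordChange_self i x _ v := by
    ext
    simp
  continuousOn_coordChange i j := by
    -- Two balls meet in a convex set, so there `g i - g j` is constant and can be evaluated at any
    -- common point.
    rcases (({x : U | (x : E) ∈ ball (i : E) (r i)} ∩
      {x : U | (x : E) ∈ ball (j : E) (r j)})).eq_empty_or_nonempty with h | ⟨x, hx⟩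
    · rw [h, empty_prod]
      exact continuousOn_empty _
    · have hc : Continuous fun p : U × DiscreteReal =>
          (⟨p.2.val + (g i x - g j x)⟩ : DiscreteReal) :=
        (continuous_of_discreteTopology (f := fun v : DiscreteReal =>
          (⟨v.val + (g i x - g j x)⟩ : DiscreteReal))).comp continuous_snd
      refine hc.continuousOn.congr fun p hp => ?_
      ext
      change p.2.val + (g i p.1 - g j p.1) = p.2.val + (g i x - g j x)
      congr 1
      exact sub_eq_sub_of_hasFDerivAt (isOpen_ball.inter isOpen_ball)
        ((convex_ball (i : E) (r i)).inter (convex_ball (j : E) (r j))).isPreconnected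
        (fun y hy => hg i y hy.1) (fun y hy => hg j y hy.2) hp.1 hx
  coordChange_comp i j k x _ v := by
    ext
    ring

/-- A locally exact form on a simply connected open set is exact. -/
theorem IsSimplyConnected.exists_primitive {E : Type*} [NormedAddCommGroup E] [NormedSpace ℝ E]
    {U : Set E} (hs : IsSimplyConnected U) (hU : IsOpen U) {ω : E → E →L[ℝ] ℝ}
    (hω : ∀ x ∈ U, ∃ r > 0, ∃ g : E → ℝ, ∀ y ∈ ball x r, HasFDerivAt g (ω y) y) :
    ∃ F : E → ℝ, ∀ x ∈ U, HasFDerivAt F (ω x) x := by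
  choose! r hr g hg using hω
  let Z := primitiveCore (U := U) (fun x => r x) (fun x => hr x x.2) (fun x => g x)
    (fun x => hg x x.2)
  have := hs.simplyConnectedSpace
  have : LocallyPathConnectedSpace U := hU.locallyPathConnectedSpace
  obtain ⟨x₀⟩ : Nonempty U := hs.nonempty.to_subtype
  have hcov : IsCoveringMap Z.proj := FiberBundle.isCoveringMap
  -- The germ bundle has discrete fibers, so it is a covering; lifting the identity of `U` yields a
  -- global section.
  obtain ⟨σ, ⟨-, hσ⟩, -⟩ := hcov.existsUnique_continuousMap_lifts (ContinuousMap.id U) x₀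
    ⟨x₀, (⟨0⟩ : DiscreteReal)⟩ rfl
  have hσ1 : ∀ x, (σ x).1 = x := fun x => congr_fun hσ x
  let v (x : U) : DiscreteReal := (σ x).2
  have hσc : ∀ i x : U, (Z.localTriv i (σ x)).2.val = (v x).val + (g x x - g i x) := by
    intro i x
    rw [Z.localTriv_apply]
    change (v x).val + (g (σ x).1 (σ x).1 - g i (σ x).1) = _
    rw [hσ1]
  classical
  -- The value at `x` of the germ chosen by the section. Near `x` the section is constant in the
  -- chart at `x`, so this function is `g x` plus a constant.
  refine ⟨fun x => if hx : x ∈ U then (v ⟨x, hx⟩).val + g x x else 0, fun x hx => ?_⟩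
  have hloc : ∀ᶠ y : U in 𝓝 ⟨x, hx⟩,
      (Z.localTriv ⟨x, hx⟩ (σ y)).2 = (Z.localTriv ⟨x, hx⟩ (σ ⟨x, hx⟩)).2 := by
    have hmem : σ ⟨x, hx⟩ ∈ (Z.localTriv ⟨x, hx⟩).source := by
      rw [Z.mem_localTriv_source, hσ1]
      exact mem_ball_self (hr x hx)
    have hc : ContinuousAt (fun y : U => (Z.localTriv ⟨x, hx⟩ (σ y)).2) ⟨x, hx⟩ :=
      continuous_snd.continuousAt.comp
        (((Z.localTriv ⟨x, hx⟩).continuousAt hmem).comp σ.continuous.continuousAt)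
    exact hc (show {v | v = _} ∈ 𝓝 _ from (isOpen_discrete _).mem_nhds rfl)
  have hev : ∀ᶠ y in 𝓝 x, ∀ hy : y ∈ U,
      (Z.localTriv ⟨x, hx⟩ (σ ⟨y, hy⟩)).2 = (Z.localTriv ⟨x, hx⟩ (σ ⟨x, hx⟩)).2 := by
    rw [nhds_subtype_eq_comap, eventually_comap] at hloc
    filter_upwards [hloc] with y hy hyU using hy ⟨y, hyU⟩ rfl
  have hd := (hg x hx x (mem_ball_self (hr x hx))).const_add (v ⟨x, hx⟩).val
  refine hd.congr_of_eventuallyEq ?_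
  filter_upwards [hev, hU.mem_nhds hx] with y hy hyU
  have h1 := hσc ⟨x, hx⟩ ⟨y, hyU⟩
  have h2 := hσc ⟨x, hx⟩ ⟨x, hx⟩
  rw [hy hyU, h2] at h1
  rw [dif_pos hyU]
  simp only [sub_self, add_zero] at h1
  linarith

/-- A function on a ball for the supremum norm whose partial derivatives vanish is constant. -/
theorem eq_center_of_hasLineDerivAt_zero {V : Type*} [Fintype V] [DecidableEq V]
    {h : (V → ℝ) → ℝ} {x : V → ℝ} {r : ℝ}
    (hh : ∀ y ∈ ball x r, ∀ i, HasLineDerivAt ℝ h 0 y (Pi.single i 1))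
    {y : V → ℝ} (hy : y ∈ ball x r) : h y = h x := by
  have hr : 0 < r := dist_nonneg.trans_lt hy
  -- Coordinates move from `x` to `y` one at a time; a supremum-norm ball is a cube, so the path
  -- stays inside.
  have key : ∀ s : Finset V, h (s.piecewise y x) = h x := by
    intro s
    induction s using Finset.induction_on with
    | empty => simp
    | insert a s ha ih =>
      rw [← ih]
      set z := s.piecewise y x with hz
      have hza : z a = x a := by simp [hz, ha]
      have hw : (insert a s).piecewise y x = z + (y a - x a) • Pi.single a (1 : ℝ) := by
        ext i
        by_cases hi : i = a
        · subst hi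
          simp [hza]
        · simp [hi, hz, Finset.piecewise]
      have hmem : ∀ t ∈ Icc (0 : ℝ) 1,
          z + (t * (y a - x a)) • Pi.single a (1 : ℝ) ∈ ball x r := by
        intro t ht
        rw [mem_ball, dist_pi_lt_iff hr]
        intro i
        have hyi : dist (y i) (x i) < r := (dist_le_pi_dist y x i).trans_lt hy
        by_cases hi : i = a
        · subst hi
          simp only [Pi.add_apply, Pi.smul_apply, Pi.single_eq_same, hza, smul_eq_mul, mul_one]
          rw [Real.dist_eq, add_sub_cancel_left, abs_mul, abs_of_nonneg ht.1]
          rw [Real.dist_eq] at hyi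
          exact (mul_le_of_le_one_left (abs_nonneg _) ht.2).trans_lt hyi
        · simp only [Pi.add_apply, Pi.smul_apply, hi, ne_eq, not_false_eq_true,
            Pi.single_eq_of_ne, smul_zero, add_zero, hz, Finset.piecewise]
          split_ifs
          · exact hyi
          · simpa using hr
      have hder : ∀ t ∈ Icc (0 : ℝ) 1, HasDerivAt
          (fun t : ℝ => h (z + (t * (y a - x a)) • Pi.single a (1 : ℝ))) 0 t := by
        intro t ht
        have h1 := hh _ (hmem t ht) a
        have h2 : HasDerivAt (fun s : ℝ => (s - t) * (y a - x a)) (y a - x a) t := by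
          simpa using ((hasDerivAt_id t).sub_const t).mul_const (y a - x a)
        have h3 := HasDerivAt.comp_of_eq t h1 h2 (by simp)
        rw [zero_mul] at h3
        refine h3.congr_of_eventuallyEq (Eventually.of_forall fun s => ?_)
        simp only [Function.comp_apply]
        congr 1
        rw [add_assoc, ← add_smul]
        ring_nf
      have := constant_of_has_deriv_right_zero (fun t ht => (hder t ht).continuousAt.continuousWithinAt)
        (fun t ht => (hder t (Ico_subset_Icc_self ht)).hasDerivWithinAt) 1 (by simp)
      rw [hw]
      simpa using this
  simpa using key Finset.univ

/-! ### The quadratic form of a weighted triangle -/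

/-- Sixteen times the squared area of a triangle, in terms of the squares of its edge lengths. -/
def heron (x y z : ℝ) : ℝ :=
  2 * x * y + 2 * y * z + 2 * z * x - x ^ 2 - y ^ 2 - z ^ 2

/-- The derivative of the angle at the first vertex of a triangle in the direction of the conformal
factor of the second vertex, where `x`, `y`, `z` are the squares of the lengths of the edges
opposite to the three vertices and `p`, `q`, `r` are the weights of the vertices. -/
noncomputable def edgeWeight (x y z p q r : ℝ) : ℝ :=
  (z * (x + y - z) + q * (y + z - x) + p * (x + z - y) - 2 * z * r) / (2 * z * √(heron x y z))

theorem heron_swap (x y z : ℝ) : heron y x z = heron x y z := by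
  unfold heron
  ring

theorem heron_rotate (x y z : ℝ) : heron y z x = heron x y z := by
  unfold heron
  ring

theorem edgeWeight_swap (x y z p q r : ℝ) : edgeWeight y x z q p r = edgeWeight x y z p q r := by
  unfold edgeWeight
  rw [heron_swap]
  ring

/-- The quadratic form with edge weights `a`, `b`, `c` on a nondegenerate triangle is nonnegative
if its trace is positive and its determinant is nonnegative. -/
theorem quadratic_form_nonneg {x y z a b c : ℝ} (hy : 0 < y) (hz : 0 < z) (hS : 0 < heron x y z)
    (htr : 0 < z * a + y * b + x * c) (hdet : 0 ≤ a * b + b * c + c * a) (s t : ℝ) :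
    0 ≤ a * s ^ 2 + b * t ^ 2 + c * (t - s) ^ 2 := by
  -- The form has matrix [[a + c, -c], [-c, b + c]].
  have hAB : c ^ 2 ≤ (a + c) * (b + c) := by nlinarith
  have hA : 0 ≤ a + c ∧ 0 ≤ b + c := by
    by_contra hcon
    have hneg : a + c ≤ 0 ∧ b + c ≤ 0 := by
      by_contra h
      rw [not_and_or, not_le, not_le] at h
      refine hcon ?_
      rcases h with h | h
      · exact ⟨h.le, nonneg_of_mul_nonneg_right ((sq_nonneg c).trans hAB) h⟩
      · exact ⟨nonneg_of_mul_nonneg_left ((sq_nonneg c).trans hAB) h, h.le⟩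
    -- A negative semidefinite form would have nonpositive trace against the positive definite Gram
    -- matrix; AM-GM bounds the off-diagonal term.
    have hP : 0 ≤ -(z * (a + c)) := by nlinarith
    have hQ : 0 ≤ -(y * (b + c)) := by nlinarith
    have hS' : (x - z - y) ^ 2 ≤ 4 * (z * y) := by
      unfold heron at hS
      nlinarith
    have h1 : ((x - z - y) * c) ^ 2 ≤ 4 * (z * y) * ((a + c) * (b + c)) := by
      rw [mul_pow]
      exact mul_le_mul hS' hAB (sq_nonneg c) (by positivity)
    have h2 : (x - z - y) * c ≤ -(z * (a + c)) + -(y * (b + c)) := by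
      refine abs_le_of_sq_le_sq' ?_ (add_nonneg hP hQ) |>.2
      nlinarith [sq_nonneg (z * (a + c) - y * (b + c))]
    nlinarith
  rcases hA.1.eq_or_lt with h0 | h0
  · have hc : c = 0 := by
      rw [← h0, zero_mul] at hAB
      exact pow_eq_zero_iff two_ne_zero |>.1 (le_antisymm hAB (sq_nonneg c))
    subst hc
    nlinarith [sq_nonneg t]
  · refine (mul_nonneg_iff_of_pos_left h0).1 ?_
    have h1 : (a + c) * (a * s ^ 2 + b * t ^ 2 + c * (t - s) ^ 2) =
        ((a + c) * s - c * t) ^ 2 + ((a + c) * (b + c) - c ^ 2) * t ^ 2 := by ring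
    rw [h1]
    exact add_nonneg (sq_nonneg _) (mul_nonneg (sub_nonneg.2 hAB) (sq_nonneg t))

/-- The power center of a triangle with weights `p`, `q`, `r` lies in its circumscribed disk. -/
theorem power_center_mem_circumdisk {x y z p q r : ℝ} (hp : 0 ≤ p) (hq : 0 ≤ q) (hr : 0 ≤ r)
    (hx : q + r ≤ x) (hy : p + r ≤ y) (hz : p + q ≤ z) :
    0 ≤ x * y * z - x * (p - q) * (p - r) - y * (q - p) * (q - r) - z * (r - p) * (r - q) := by
  have h1 : ∀ {u v s t : ℝ}, 0 ≤ u → 0 ≤ v → 0 ≤ s → 0 ≤ t → (u - v) * (s - t) ≤ (u + v) * (s + t) := by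
    intro u v s t hu hv hs ht
    nlinarith [mul_nonneg hu ht, mul_nonneg hv hs]
  -- The expression is affine in each of `x`, `y`, `z`. Lowering them in turn to their least values
  -- (pairwise orthogonal circles) decreases it, down to 8pqr.
  have e1 : 0 ≤ (x - (q + r)) * (y * z - (p - q) * (p - r)) := by
    refine mul_nonneg (by linarith) ?_
    have := h1 hp hq hp hr
    have := mul_le_mul hy hz (by positivity) (by linarith)
    nlinarith
  have e2 : 0 ≤ (y - (p + r)) * ((q + r) * z - (q - p) * (q - r)) := by
    refine mul_nonneg (by linarith) ?_
    have := h1 hq hp hq hr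
    have := mul_le_mul_of_nonneg_left hz (add_nonneg hq hr)
    nlinarith
  have e3 : 0 ≤ (z - (p + q)) * ((q + r) * (p + r) - (r - p) * (r - q)) := by
    refine mul_nonneg (by linarith) ?_
    have := h1 hr hp hr hq
    nlinarith
  have e4 : 0 ≤ p * q * r := by positivity
  linarith

theorem edgeWeight_form_nonneg {x y z p q r : ℝ} (hp : 0 ≤ p) (hq : 0 ≤ q) (hr : 0 ≤ r)
    (hx : q + r ≤ x) (hy : p + r ≤ y) (hz : p + q ≤ z) (hx0 : 0 < x) (hy0 : 0 < y) (hz0 : 0 < z)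
    (hS : 0 < heron x y z) (u v w : ℝ) :
    0 ≤ edgeWeight x y z p q r * (v - u) ^ 2 + edgeWeight y z x q r p * (w - v) ^ 2 +
      edgeWeight z x y r p q * (u - w) ^ 2 := by
  have hsqrt : 0 < √(heron x y z) := Real.sqrt_pos.2 hS
  -- The triangles from the power center to the edges have signed areas summing to the whole area.
  have htr : z * ((z * (x + y - z) + q * (y + z - x) + p * (x + z - y) - 2 * z * r) / z) +
      y * ((y * (z + x - y) + p * (x + y - z) + r * (z + y - x) - 2 * y * q) / y) +
      x * ((x * (y + z - x) + r * (z + x - y) + q * (y + x - z) - 2 * x * p) / x) =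
      heron x y z := by
    rw [mul_div_cancel₀ _ hz0.ne', mul_div_cancel₀ _ hy0.ne', mul_div_cancel₀ _ hx0.ne']
    unfold heron
    ring
  have hdet : (z * (x + y - z) + q * (y + z - x) + p * (x + z - y) - 2 * z * r) / z *
        ((y * (z + x - y) + p * (x + y - z) + r * (z + y - x) - 2 * y * q) / y) +
      (y * (z + x - y) + p * (x + y - z) + r * (z + y - x) - 2 * y * q) / y *
        ((x * (y + z - x) + r * (z + x - y) + q * (y + x - z) - 2 * x * p) / x) +
      (x * (y + z - x) + r * (z + x - y) + q * (y + x - z) - 2 * x * p) / x *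
        ((z * (x + y - z) + q * (y + z - x) + p * (x + z - y) - 2 * z * r) / z) =
      heron x y z * (x * y * z - x * (p - q) * (p - r) - y * (q - p) * (q - r) -
        z * (r - p) * (r - q)) / (x * y * z) := by
    unfold heron
    field_simp
    ring
  have key := quadratic_form_nonneg hy0 hz0 hS (htr ▸ hS) (hdet ▸ div_nonneg
    (mul_nonneg hS.le (power_center_mem_circumdisk hp hq hr hx hy hz)) (by positivity))
    (v - u) (w - u)
  have h2 : edgeWeight x y z p q r * (v - u) ^ 2 + edgeWeight y z x q r p * (w - v) ^ 2 +
      edgeWeight z x y r p q * (u - w) ^ 2 = 1 / (2 * √(heron x y z)) *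
      ((z * (x + y - z) + q * (y + z - x) + p * (x + z - y) - 2 * z * r) / z * (v - u) ^ 2 +
      (y * (z + x - y) + p * (x + y - z) + r * (z + y - x) - 2 * y * q) / y * (w - u) ^ 2 +
      (x * (y + z - x) + r * (z + x - y) + q * (y + x - z) - 2 * x * p) / x *
        (w - u - (v - u)) ^ 2) := by
    unfold edgeWeight
    rw [heron_rotate x y z, ← heron_rotate z x y]
    field_simp
    ring
  rw [h2]
  exact mul_nonneg (by positivity) key

/-! ### Differentiating the law of cosines -/

theorem hasFDerivAt_arccos_cosine_law {E : Type*} [NormedAddCommGroup E] [NormedSpace ℝ E]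
    {a b c : E → ℝ} {a' b' c' L : E →L[ℝ] ℝ} {f : E} (ha : HasFDerivAt a a' f)
    (hb : HasFDerivAt b b' f) (hc : HasFDerivAt c c' f) (ha0 : 0 < a f) (hb0 : 0 < b f)
    (hS : 0 < heron (c f ^ 2) (b f ^ 2) (a f ^ 2))
    (hL : ∀ v, L v * √(heron (c f ^ 2) (b f ^ 2) (a f ^ 2)) = 2 * c f * c' v +
      b' v * (a f ^ 2 - c f ^ 2 - b f ^ 2) / b f + a' v * (b f ^ 2 - c f ^ 2 - a f ^ 2) / a f) :
    HasFDerivAt (fun f => Real.arccos ((a f ^ 2 + b f ^ 2 - c f ^ 2) / (2 * a f * b f))) L f := by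
  set S := √(heron (c f ^ 2) (b f ^ 2) (a f ^ 2)) with hSdef
  have hS0 : 0 < S := Real.sqrt_pos.2 hS
  have hSS : S ^ 2 = heron (c f ^ 2) (b f ^ 2) (a f ^ 2) := Real.sq_sqrt hS.le
  set A := a f with hA
  set B := b f with hB
  set C := c f with hC
  -- The squared sine of the angle, as S is four times the area.
  have h1 : 1 - ((A ^ 2 + B ^ 2 - C ^ 2) / (2 * A * B)) ^ 2 = (S / (2 * A * B)) ^ 2 := by
    rw [div_pow S, hSS]
    unfold heron
    field_simp
    ring
  have h2 : √(1 - ((A ^ 2 + B ^ 2 - C ^ 2) / (2 * A * B)) ^ 2) = S / (2 * A * B) := by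
    rw [h1, Real.sqrt_sq (by positivity)]
  have h3 : 0 < 1 - ((A ^ 2 + B ^ 2 - C ^ 2) / (2 * A * B)) ^ 2 := by
    rw [h1]
    positivity
  have hn1 : (A ^ 2 + B ^ 2 - C ^ 2) / (2 * A * B) ≠ -1 := fun h => by
    rw [h] at h3
    norm_num at h3
  have hn2 : (A ^ 2 + B ^ 2 - C ^ 2) / (2 * A * B) ≠ 1 := fun h => by
    rw [h] at h3
    norm_num at h3
  have hinv := (hasDerivAt_inv (show 2 * A * B ≠ 0 by positivity)).comp_hasFDerivAt f
    ((ha.const_mul 2).mul hb)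
  have hq := (((ha.pow 2).add (hb.pow 2)).sub (hc.pow 2)).mul hinv
  have hd := (Real.hasDerivAt_arccos hn1 hn2).comp_hasFDerivAt f hq
  refine hd.congr_fderiv ?_
  ext v
  rw [h2]
  refine mul_right_cancel₀ hS0.ne' ?_
  rw [hL]
  simp [← hA, ← hB, ← hC]
  field_simp
  ring

/-! ### Potentials of fields with symmetric Jacobian -/

section Potential

variable {V : Type*} [Fintype V] {U : Set (V → ℝ)} {K : V → (V → ℝ) → ℝ}
  {DK : V → (V → ℝ) → (V → ℝ) →L[ℝ] ℝ}

/-- The form `∑ K i dx_i`. -/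
noncomputable def gradientForm (K : V → (V → ℝ) → ℝ) (f : V → ℝ) : (V → ℝ) →L[ℝ] ℝ :=
  ∑ i, K i f • ContinuousLinearMap.proj (R := ℝ) (φ := fun _ : V => ℝ) i

theorem gradientForm_apply (f v : V → ℝ) : gradientForm K f v = ∑ i, K i f * v i := by
  simp [gradientForm]

theorem gradientForm_single [DecidableEq V] (f : V → ℝ) (i : V) :
    gradientForm K f (Pi.single i 1) = K i f := by
  simp [gradientForm_apply, Pi.single_apply]

/-- Symmetry of the Jacobian is closedness of the form; the Poincaré lemma holds on balls. -/
theorem exists_local_primitive (hU : IsOpen U)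
    (hK : ∀ f ∈ U, ∀ i, HasFDerivAt (K i) (DK i f) f)
    (hsymm : ∀ f ∈ U, ∀ u v : V → ℝ, ∑ i, v i * DK i f u = ∑ i, u i * DK i f v)
    {x : V → ℝ} (hx : x ∈ U) :
    ∃ r > 0, ball x r ⊆ U ∧ ∃ g : (V → ℝ) → ℝ,
      ∀ y ∈ ball x r, HasFDerivAt g (gradientForm K y) y := by
  obtain ⟨r, hr, hrU⟩ := Metric.isOpen_iff.1 hU x hx
  refine ⟨r, hr, hrU, ?_⟩
  have hd : ∀ y ∈ ball x r, HasFDerivAt (gradientForm K) (∑ i, (DK i y).smulRight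
      (ContinuousLinearMap.proj (R := ℝ) (φ := fun _ : V => ℝ) i)) y := fun y hy =>
    HasFDerivAt.fun_sum fun i _ => HasFDerivAt.smul_const (F := (V → ℝ) →L[ℝ] ℝ)
      (hK y (hrU hy) i) (ContinuousLinearMap.proj i)
  refine (convex_ball x r).exists_forall_hasFDerivAt_of_fderiv_symmetric isOpen_ball
    (fun y hy => (hd y hy).differentiableAt.differentiableWithinAt) fun y hy u v => ?_
  rw [(hd y hy).fderiv]
  simpa [sum_apply, mul_comm] using hsymm y (hrU hy) u v

theorem IsSimplyConnected.exists_potential (hs : IsSimplyConnected U) (hU : IsOpen U)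
    (hK : ∀ f ∈ U, ∀ i, HasFDerivAt (K i) (DK i f) f)
    (hsymm : ∀ f ∈ U, ∀ u v : V → ℝ, ∑ i, v i * DK i f u = ∑ i, u i * DK i f v) :
    ∃ F : (V → ℝ) → ℝ, ∀ f ∈ U, HasFDerivAt F (gradientForm K f) f :=
  hs.exists_primitive hU fun _ hx =>
    let ⟨r, hr, _, h⟩ := exists_local_primitive hU hK hsymm hx
    ⟨r, hr, h⟩

/-- Only partial derivatives of `F` are given; subtracting a local primitive leaves vanishing
partials, so the difference is locally constant. -/
theorem hasFDerivAt_of_hasLineDerivAt [DecidableEq V] (hU : IsOpen U)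
    (hK : ∀ f ∈ U, ∀ i, HasFDerivAt (K i) (DK i f) f)
    (hsymm : ∀ f ∈ U, ∀ u v : V → ℝ, ∑ i, v i * DK i f u = ∑ i, u i * DK i f v)
    {F : (V → ℝ) → ℝ} (hF : ∀ f ∈ U, ∀ i, HasLineDerivAt ℝ F (K i f) f (Pi.single i 1))
    {x : V → ℝ} (hx : x ∈ U) : HasFDerivAt F (gradientForm K x) x := by
  obtain ⟨r, hr, hrU, g, hg⟩ := exists_local_primitive hU hK hsymm hx
  have hd : ∀ y ∈ ball x r, F y - g y = F x - g x := fun y hy =>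
    eq_center_of_hasLineDerivAt_zero (h := fun y => F y - g y) (fun z hz i => by
      have := (hF z (hrU hz) i).sub ((hg z hz).hasLineDerivAt (Pi.single i 1))
      rwa [gradientForm_single, sub_self] at this) hy
  refine ((hg x (mem_ball_self hr)).const_add (F x - g x)).congr_of_eventuallyEq ?_
  filter_upwards [ball_mem_nhds x hr] with y hy
  rw [← hd y hy, sub_add_cancel]

theorem convexOn_of_hessian_nonneg
    (hK : ∀ f ∈ U, ∀ i, HasFDerivAt (K i) (DK i f) f)
    (hpos : ∀ f ∈ U, ∀ v : V → ℝ, 0 ≤ ∑ i, v i * DK i f v)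
    {F : (V → ℝ) → ℝ} (hF : ∀ f ∈ U, HasFDerivAt F (gradientForm K f) f)
    {S : Set (V → ℝ)} (hSU : S ⊆ U) (hS : Convex ℝ S) : ConvexOn ℝ S F := by
  refine ⟨hS, fun x hx y hy a b ha hb hab => ?_⟩
  have hmem : ∀ t ∈ Icc (0 : ℝ) 1, x + t • (y - x) ∈ U := fun t ht =>
    hSU (hS.add_smul_sub_mem hx hy ht)
  have hline : ∀ t : ℝ, HasDerivAt (fun t : ℝ => x + t • (y - x)) (y - x) t := fun t => by
    simpa using ((hasDerivAt_id t).smul_const (y - x)).const_add x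
  have h1 : ∀ t ∈ Icc (0 : ℝ) 1, HasDerivAt (fun t : ℝ => F (x + t • (y - x)))
      (∑ i, K i (x + t • (y - x)) * (y - x) i) t := fun t ht => by
    have := (hF _ (hmem t ht)).comp_hasDerivAt t (hline t)
    rwa [gradientForm_apply] at this
  have h2 : ∀ t ∈ Icc (0 : ℝ) 1, HasDerivAt
      (fun t : ℝ => ∑ i, K i (x + t • (y - x)) * (y - x) i)
      (∑ i, DK i (x + t • (y - x)) (y - x) * (y - x) i) t := fun t ht =>
    HasDerivAt.fun_sum fun i _ =>
      ((hK _ (hmem t ht) i).comp_hasDerivAt t (hline t)).mul_const _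
  have hc : ConvexOn ℝ (Icc (0 : ℝ) 1) (fun t : ℝ => F (x + t • (y - x))) :=
    convexOn_of_hasDerivWithinAt2_nonneg (convex_Icc 0 1)
      (fun t ht => (h1 t ht).continuousAt.continuousWithinAt)
      (fun t ht => (h1 t (interior_subset ht)).hasDerivWithinAt)
      (fun t ht => (h2 t (interior_subset ht)).hasDerivWithinAt)
      (fun t ht => by
        simpa only [mul_comm] using hpos _ (hmem t (interior_subset ht)) (y - x))
  have := hc.2 (left_mem_Icc.2 zero_le_one) (right_mem_Icc.2 zero_le_one) ha hb hab
  have he : a • x + b • y = x + b • (y - x) := by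
    rw [← eq_sub_iff_add_eq] at hab
    rw [hab]
    module
  rw [he]
  simpa using this

end Potential

/-! ### Sums over ordered triples -/

/-- Summation by parts: exchanging `j` and `k` merges the two terms, and exchanging `i` and `j`
symmetrizes. -/
theorem sum_mul_laplacian {V : Type*} [Fintype V] {W : V → V → V → ℝ}
    (hW : ∀ i j k, W i j k = W j i k) (u v : V → ℝ) :
    ∑ i, u i * (-(1 / 2) * ∑ j, ∑ k, (W i j k * (v j - v i) + W i k j * (v k - v i))) =
      1 / 2 * ∑ i, ∑ j, ∑ k, W i j k * ((u j - u i) * (v j - v i)) := by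
  have h1 : ∀ i, ∑ j, ∑ k, (W i j k * (v j - v i) + W i k j * (v k - v i)) =
      2 * ∑ j, ∑ k, W i j k * (v j - v i) := by
    intro i
    simp only [Finset.sum_add_distrib]
    rw [Finset.sum_comm (f := fun j k => W i k j * (v k - v i))]
    ring
  have h2 : ∑ i, ∑ j, ∑ k, W i j k * ((u j - u i) * (v j - v i)) =
      ∑ i, ∑ j, ∑ k, W i j k * (u j * (v j - v i)) -
        ∑ i, ∑ j, ∑ k, W i j k * (u i * (v j - v i)) := by
    simp only [← Finset.sum_sub_distrib]
    refine Finset.sum_congr rfl fun i _ => Finset.sum_congr rfl fun j _ =>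
      Finset.sum_congr rfl fun k _ => ?_
    ring
  have h3 : ∑ i, ∑ j, ∑ k, W i j k * (u j * (v j - v i)) =
      -∑ i, ∑ j, ∑ k, W i j k * (u i * (v j - v i)) := by
    rw [Finset.sum_comm]
    simp only [← Finset.sum_neg_distrib]
    refine Finset.sum_congr rfl fun i _ => Finset.sum_congr rfl fun j _ =>
      Finset.sum_congr rfl fun k _ => ?_
    rw [hW]
    ring
  have h4 : ∑ i, u i * (-(1 / 2) * ∑ j, ∑ k, (W i j k * (v j - v i) + W i k j * (v k - v i))) =
      -∑ i, ∑ j, ∑ k, W i j k * (u i * (v j - v i)) := by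
    rw [← Finset.sum_neg_distrib]
    refine Finset.sum_congr rfl fun i _ => ?_
    rw [h1]
    calc u i * (-(1 / 2) * (2 * ∑ j, ∑ k, W i j k * (v j - v i)))
        = -(u i * ∑ j, ∑ k, W i j k * (v j - v i)) := by ring
      _ = _ := by
        simp only [Finset.mul_sum]
        congr 1
        refine Finset.sum_congr rfl fun j _ => Finset.sum_congr rfl fun k _ => ?_
        ring
  rw [h4, h2, h3]
  ring

theorem sum_nonneg_of_cyclic {V : Type*} [Fintype V] {g : V → V → V → ℝ}
    (hg : ∀ i j k, 0 ≤ g i j k + g j k i + g k i j) : 0 ≤ ∑ i, ∑ j, ∑ k, g i j k := by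
  have h1 : ∑ i, ∑ j, ∑ k, g j k i = ∑ i, ∑ j, ∑ k, g i j k := by
    rw [Finset.sum_comm]
    exact Finset.sum_congr rfl fun i _ => Finset.sum_comm
  have h2 : ∑ i, ∑ j, ∑ k, g k i j = ∑ i, ∑ j, ∑ k, g i j k := by
    rw [← h1, Finset.sum_comm]
    exact Finset.sum_congr rfl fun i _ => Finset.sum_comm
  have h3 : 0 ≤ ∑ i, ∑ j, ∑ k, (g i j k + g j k i + g k i j) :=
    Finset.sum_nonneg fun i _ => Finset.sum_nonneg fun j _ => Finset.sum_nonneg fun k _ => hg i j k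
  simp only [Finset.sum_add_distrib] at h3
  linarith

theorem injective_vec3 {α : Type*} {a b c : α} (hab : a ≠ b) (hac : a ≠ c) (hbc : b ≠ c) :
    Function.Injective ![a, b, c] := by
  intro s t hst
  fin_cases s <;> fin_cases t <;> simp_all [eq_comm]

/-! ### Nondegenerate triangles -/

namespace PiecewiseFlat

variable {V : Type*}

theorem IsTriangle.rotate {T : AbstractSimplicialComplex V} {i j k : V} (h : IsTriangle T i j k) :
    IsTriangle T j k i := by
  classical
  obtain ⟨h1, h2, h3, h4⟩ := h
  refine ⟨h3, h1.symm, h2.symm, ?_⟩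
  convert h4 using 1
  ext x
  simp
  tauto

theorem IsTriangle.swap {T : AbstractSimplicialComplex V} {i j k : V} (h : IsTriangle T i j k) :
    IsTriangle T j i k := by
  classical
  obtain ⟨h1, h2, h3, h4⟩ := h
  refine ⟨h1.symm, h3, h2, ?_⟩
  convert h4 using 1
  ext x
  simp
  tauto

theorem IsTriangle.isEdge {T : AbstractSimplicialComplex V} {i j k : V} (h : IsTriangle T i j k) :
    IsEdge T i j := by
  classical
  refine ⟨h.1, (T.isRelLowerSet_faces h.2.2.2).2 ?_ ⟨i, by simp⟩⟩
  intro x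
  simp
  tauto

theorem IsPiecewiseFlat.pos {T : AbstractSimplicialComplex V} {ℓ : Sym2 V → ℝ}
    (hℓ : IsPiecewiseFlat T ℓ) {i j : V} (h : IsEdge T i j) : 0 < ℓ s(i, j) := by
  classical
  obtain ⟨n, p, hp, hd⟩ := hℓ _ h.2
  have hij : (⟨i, by simp⟩ : ({i, j} : Finset V)) ≠ ⟨j, by simp⟩ := fun he =>
    h.1 (congrArg Subtype.val he)
  rw [← hd _ _ hij]
  exact dist_pos.2 (hp.injective.ne hij)

/-- Noncollinearity makes the triangle inequalities strict, and `heron` factors as in Heron's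
formula. -/
theorem IsPiecewiseFlat.heron_pos {T : AbstractSimplicialComplex V} {ℓ : Sym2 V → ℝ}
    (hℓ : IsPiecewiseFlat T ℓ) {i j k : V} (h : IsTriangle T i j k) :
    0 < heron (ℓ s(j, k) ^ 2) (ℓ s(i, k) ^ 2) (ℓ s(i, j) ^ 2) := by
  classical
  obtain ⟨n, p, hp, hd⟩ := hℓ _ h.2.2.2
  let a : ({i, j, k} : Finset V) := ⟨i, by simp⟩
  let b : ({i, j, k} : Finset V) := ⟨j, by simp⟩
  let c : ({i, j, k} : Finset V) := ⟨k, by simp⟩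
  have hab : a ≠ b := fun he => h.1 (congrArg Subtype.val he)
  have hac : a ≠ c := fun he => h.2.1 (congrArg Subtype.val he)
  have hbc : b ≠ c := fun he => h.2.2.1 (congrArg Subtype.val he)
  have hnc : ¬ Collinear ℝ {p a, p b, p c} := by
    rw [← affineIndependent_iff_not_collinear_set]
    have hcomp : ![p a, p b, p c] = p ∘ ![a, b, c] := by
      funext s
      fin_cases s <;> rfl
    rw [hcomp]
    exact hp.comp_embedding ⟨![a, b, c], injective_vec3 hab hac hbc⟩
  have strict : ∀ {x y z : EuclideanSpace ℝ (Fin n)}, ¬ Collinear ℝ {x, y, z} →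
      dist x z < dist x y + dist y z := fun hxyz =>
    lt_of_le_of_ne (dist_triangle _ _ _) fun he =>
      hxyz (dist_add_dist_eq_iff.1 he.symm).collinear
  have h1 : dist (p a) (p c) < dist (p a) (p b) + dist (p b) (p c) := strict hnc
  have h2 : dist (p b) (p c) < dist (p b) (p a) + dist (p a) (p c) := strict fun hc =>
    hnc (by rwa [insert_comm] at hc)
  have h3 : dist (p a) (p b) < dist (p a) (p c) + dist (p c) (p b) := strict fun hc =>
    hnc (by rwa [pair_comm] at hc)
  rw [dist_comm (p b) (p a)] at h2
  rw [dist_comm (p c) (p b)] at h3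
  rw [hd a b hab, hd a c hac, hd b c hbc] at h1 h2 h3
  change ℓ s(i, k) < ℓ s(i, j) + ℓ s(j, k) at h1
  change ℓ s(j, k) < ℓ s(i, j) + ℓ s(i, k) at h2
  change ℓ s(i, j) < ℓ s(i, k) + ℓ s(j, k) at h3
  have he : heron (ℓ s(j, k) ^ 2) (ℓ s(i, k) ^ 2) (ℓ s(i, j) ^ 2) =
      (ℓ s(i, j) + ℓ s(i, k) + ℓ s(j, k)) * (ℓ s(i, j) + ℓ s(j, k) - ℓ s(i, k)) *
      (ℓ s(i, j) + ℓ s(i, k) - ℓ s(j, k)) * (ℓ s(i, k) + ℓ s(j, k) - ℓ s(i, j)) := by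
    unfold heron
    ring
  rw [he]
  refine mul_pos (mul_pos (mul_pos ?_ ?_) ?_) ?_ <;> linarith

/-! ### Variation of angles and curvature -/

/-- A conformal structure `C` with vertex weights `p`: the squared lengths satisfy
`∂ℓ_ij²/∂f_i = ℓ_ij² + p_i - p_j`, and circles with squared radii `p_i`, `p_j` and centers at
distance `ℓ_ij` meet at most orthogonally. -/
structure IsConformalOn [Fintype V] (T : AbstractSimplicialComplex V) (C : (V → ℝ) → V → V → ℝ)
    (p : V → (V → ℝ) → ℝ) (U : Set (V → ℝ)) : Prop where
  piecewiseFlat : ∀ f ∈ U, IsPiecewiseFlat T (len (C f))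
  weight_nonneg : ∀ i f, 0 ≤ p i f
  weight_add_le : ∀ f ∈ U, ∀ i j, IsEdge T i j → p i f + p j f ≤ len (C f) s(i, j) ^ 2
  hasFDerivAt_len : ∀ f ∈ U, ∀ i j, IsEdge T i j → HasFDerivAt (fun f => len (C f) s(i, j))
    (((len (C f) s(i, j) ^ 2 + p i f - p j f) / (2 * len (C f) s(i, j))) •
      ContinuousLinearMap.proj (R := ℝ) (φ := fun _ : V => ℝ) i +
    ((len (C f) s(i, j) ^ 2 + p j f - p i f) / (2 * len (C f) s(i, j))) •
      ContinuousLinearMap.proj (R := ℝ) (φ := fun _ : V => ℝ) j) f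

open Classical in
/-- The weight of the edge `{i, j}` in the triangle `{i, j, k}`. -/
noncomputable def triangleWeight (T : AbstractSimplicialComplex V) (ℓ : Sym2 V → ℝ) (p : V → ℝ) (i j k : V) : ℝ :=
  if IsTriangle T i j k then
    edgeWeight (ℓ s(j, k) ^ 2) (ℓ s(i, k) ^ 2) (ℓ s(i, j) ^ 2) (p i) (p j) (p k) else 0

theorem triangleWeight_swap (T : AbstractSimplicialComplex V) (ℓ : Sym2 V → ℝ) (p : V → ℝ)
    (i j k : V) : triangleWeight T ℓ p i j k = triangleWeight T ℓ p j i k := by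
  unfold triangleWeight
  by_cases h : IsTriangle T i j k
  · rw [if_pos h, if_pos h.swap, edgeWeight_swap, Sym2.eq_swap (a := j) (b := i)]
  · rw [if_neg h, if_neg fun h' => h h'.swap]

variable [Fintype V] {T : AbstractSimplicialComplex V} {C : (V → ℝ) → V → V → ℝ}
  {p : V → (V → ℝ) → ℝ} {U : Set (V → ℝ)}

theorem IsConformalOn.hasFDerivAt_angle (hC : IsConformalOn T C p U) {f : V → ℝ} (hf : f ∈ U)
    {i j k : V} (h : IsTriangle T i j k) : HasFDerivAt (fun f => angle (len (C f)) i j k)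
      (triangleWeight T (len (C f)) (p · f) i j k •
        (ContinuousLinearMap.proj (R := ℝ) (φ := fun _ : V => ℝ) j - ContinuousLinearMap.proj i) +
      triangleWeight T (len (C f)) (p · f) i k j •
        (ContinuousLinearMap.proj (R := ℝ) (φ := fun _ : V => ℝ) k - ContinuousLinearMap.proj i))
      f := by
  have hik : IsTriangle T i k j := h.rotate.rotate.swap
  have pij := (hC.piecewiseFlat f hf).pos h.isEdge
  have pik := (hC.piecewiseFlat f hf).pos hik.isEdge
  have pjk := (hC.piecewiseFlat f hf).pos h.rotate.isEdge
  have hS := (hC.piecewiseFlat f hf).heron_pos h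
  refine hasFDerivAt_arccos_cosine_law (hC.hasFDerivAt_len f hf i j h.isEdge)
    (hC.hasFDerivAt_len f hf i k hik.isEdge) (hC.hasFDerivAt_len f hf j k h.rotate.isEdge)
    pij pik hS fun v => ?_
  unfold triangleWeight
  rw [if_pos h, if_pos hik, Sym2.eq_swap (a := k) (b := j)]
  unfold edgeWeight
  have hs2 : heron (len (C f) s(j, k) ^ 2) (len (C f) s(i, j) ^ 2) (len (C f) s(i, k) ^ 2) =
      heron (len (C f) s(j, k) ^ 2) (len (C f) s(i, k) ^ 2) (len (C f) s(i, j) ^ 2) := by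
    unfold heron
    ring
  rw [hs2]
  have hS0 := Real.sqrt_pos.2 hS
  simp
  field_simp
  ring

open Classical in
theorem IsConformalOn.hasFDerivAt_curvature (hC : IsConformalOn T C p U) {f : V → ℝ} (hf : f ∈ U)
    (i : V) : HasFDerivAt (fun f => curvature T (len (C f)) i)
      (-(1 / 2 : ℝ) • ∑ j, ∑ k, (triangleWeight T (len (C f)) (p · f) i j k •
        (ContinuousLinearMap.proj (R := ℝ) (φ := fun _ : V => ℝ) j - ContinuousLinearMap.proj i) +
      triangleWeight T (len (C f)) (p · f) i k j •
        (ContinuousLinearMap.proj (R := ℝ) (φ := fun _ : V => ℝ) k - ContinuousLinearMap.proj i)))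
      f := by
  have h1 : ∀ j k, HasFDerivAt
      (fun f => if IsTriangle T i j k then angle (len (C f)) i j k else 0)
      (triangleWeight T (len (C f)) (p · f) i j k •
        (ContinuousLinearMap.proj (R := ℝ) (φ := fun _ : V => ℝ) j - ContinuousLinearMap.proj i) +
      triangleWeight T (len (C f)) (p · f) i k j •
        (ContinuousLinearMap.proj (R := ℝ) (φ := fun _ : V => ℝ) k - ContinuousLinearMap.proj i))
      f := by
    intro j k
    by_cases h : IsTriangle T i j k
    · simpa only [if_pos h] using hC.hasFDerivAt_angle hf h
    · have h' : ¬ IsTriangle T i k j := fun h' => h h'.rotate.rotate.swap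
      simp only [if_neg h, triangleWeight, if_neg h', zero_smul, add_zero]
      exact hasFDerivAt_const _ _
  have h2 := ((HasFDerivAt.fun_sum (u := Finset.univ) fun j _ =>
    HasFDerivAt.fun_sum (u := Finset.univ) fun k _ => h1 j k).const_mul (1 / 2)).const_sub
      (2 * Real.pi)
  rw [← neg_smul] at h2
  exact h2

theorem IsConformalOn.exists_hessian (hC : IsConformalOn T C p U) :
    ∃ DK : V → (V → ℝ) → (V → ℝ) →L[ℝ] ℝ,
      (∀ f ∈ U, ∀ i, HasFDerivAt (fun f => curvature T (len (C f)) i) (DK i f) f) ∧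
      (∀ f ∈ U, ∀ u v : V → ℝ, ∑ i, v i * DK i f u = ∑ i, u i * DK i f v) ∧
      ∀ f ∈ U, ∀ v : V → ℝ, 0 ≤ ∑ i, v i * DK i f v := by
  have hform : ∀ (f u v : V → ℝ), ∑ i, u i * (-(1 / 2 : ℝ) • ∑ j, ∑ k,
      (triangleWeight T (len (C f)) (p · f) i j k •
        (ContinuousLinearMap.proj (R := ℝ) (φ := fun _ : V => ℝ) j - ContinuousLinearMap.proj i) +
      triangleWeight T (len (C f)) (p · f) i k j •
        (ContinuousLinearMap.proj (R := ℝ) (φ := fun _ : V => ℝ) k -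
          ContinuousLinearMap.proj i)) : (V → ℝ) →L[ℝ] ℝ) v =
      1 / 2 * ∑ i, ∑ j, ∑ k, triangleWeight T (len (C f)) (p · f) i j k *
        ((u j - u i) * (v j - v i)) := by
    intro f u v
    rw [← sum_mul_laplacian (triangleWeight_swap T (len (C f)) (p · f))]
    simp [sum_apply]
  refine ⟨_, fun f hf i => hC.hasFDerivAt_curvature hf i, fun f hf u v => ?_, fun f hf v => ?_⟩
  · rw [hform, hform]
    simp only [mul_comm]
  · rw [hform]
    -- Cyclic rotations of a triple collect the three edges of one triangle.
    refine mul_nonneg (by norm_num) (sum_nonneg_of_cyclic fun i j k => ?_)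
    unfold triangleWeight
    by_cases h : IsTriangle T i j k
    · rw [if_pos h, if_pos h.rotate, if_pos h.rotate.rotate]
      have hfl := hC.piecewiseFlat f hf
      have hij := h.isEdge
      have hjk := h.rotate.isEdge
      have hik := h.rotate.rotate.swap.isEdge
      have := edgeWeight_form_nonneg (hC.weight_nonneg i f) (hC.weight_nonneg j f)
        (hC.weight_nonneg k f) (hC.weight_add_le f hf j k hjk) (hC.weight_add_le f hf i k hik)
        (hC.weight_add_le f hf i j hij) (pow_pos (hfl.pos hjk) 2) (pow_pos (hfl.pos hik) 2)
        (pow_pos (hfl.pos hij) 2) (hfl.heron_pos h) (v i) (v j) (v k)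
      rw [Sym2.eq_swap (a := k) (b := i), Sym2.eq_swap (a := j) (b := i),
        Sym2.eq_swap (a := k) (b := j)]
      simpa only [pow_two] using this
    · rw [if_neg h, if_neg fun h' => h h'.rotate.rotate, if_neg fun h' => h h'.rotate]
      simp

theorem IsConformalOn.exists_isCurvatureFunctional (hC : IsConformalOn T C p U) (hU : IsOpen U)
    (hs : IsSimplyConnected U) : ∃ F, IsCurvatureFunctional T C U F := by
  classical
  obtain ⟨DK, h1, h2, -⟩ := hC.exists_hessian
  obtain ⟨F, hF⟩ := hs.exists_potential (K := fun i f => curvature T (len (C f)) i) hU h1 h2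
  refine ⟨F, fun f hf i => ?_⟩
  have := (hF f hf).hasLineDerivAt (Pi.single i 1)
  rw [gradientForm_single] at this
  convert this

theorem IsConformalOn.convexOn (hC : IsConformalOn T C p U) (hU : IsOpen U)
    {F : (V → ℝ) → ℝ} (hF : IsCurvatureFunctional T C U F) {S : Set (V → ℝ)} (hSU : S ⊆ U)
    (hS : Convex ℝ S) : ConvexOn ℝ S F := by
  classical
  obtain ⟨DK, h1, h2, h3⟩ := hC.exists_hessian
  refine convexOn_of_hessian_nonneg (K := fun i f => curvature T (len (C f)) i) h1 h3
    (fun f hf => hasFDerivAt_of_hasLineDerivAt hU h1 h2 (fun g hg i => ?_) hf) hSU hS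
  convert hF g hg i

/-! ### The two conformal structures -/

theorem isConformalOn_perpBisector {L : Sym2 V → ℝ}
    (hU : ∀ f ∈ U, IsMetric T (perpBisector L f)) :
    IsConformalOn T (perpBisector L) (fun _ _ => 0) U where
  piecewiseFlat f hf := (hU f hf).piecewiseFlat
  weight_nonneg _ _ := le_rfl
  weight_add_le f _ i j _ := by
    rw [add_zero]
    exact sq_nonneg _
  hasFDerivAt_len f hf i j h := by
    have hpos := (hU f hf).piecewiseFlat.pos h
    have hlen : ∀ f : V → ℝ, len (perpBisector L f) s(i, j) =
        Real.exp ((f i + f j) / 2) * L s(i, j) := by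
      intro f
      simp only [len, Sym2.lift_mk, perpBisector]
      rw [Sym2.eq_swap (a := j) (b := i), add_comm (f j) (f i)]
      ring
    have hd := ((((ContinuousLinearMap.proj (R := ℝ) (φ := fun _ : V => ℝ) i).hasFDerivAt
      (x := f)).add ((ContinuousLinearMap.proj (R := ℝ) (φ := fun _ : V => ℝ) j).hasFDerivAt
      (x := f))).mul_const (1 / 2)).exp.mul_const (L s(i, j))
    rw [hlen] at hpos
    simp only [hlen]
    refine (hd.congr_fderiv ?_).congr_of_eventuallyEq (Eventually.of_forall fun g => ?_)
    · ext v
      simp [← div_eq_mul_inv]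
      field_simp
    · simp [div_eq_mul_inv]

theorem isConformalOn_fixedInversive {η : Sym2 V → ℝ}
    (hη : ∀ i j, IsEdge T i j → 0 ≤ η s(i, j))
    (hU : ∀ f ∈ U, IsMetric T (fixedInversive η f)) :
    IsConformalOn T (fixedInversive η) (fun i f => Real.exp (2 * f i)) U := by
  have hsq : ∀ x : ℝ, Real.exp (2 * x) = Real.exp x ^ 2 := fun x => by
    rw [two_mul, Real.exp_add, pow_two]
  have hQ : ∀ i j, IsEdge T i j → ∀ f : V → ℝ, 0 < Real.exp (f i) ^ 2 + Real.exp (f j) ^ 2 +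
      2 * Real.exp (f i) * Real.exp (f j) * η s(i, j) := fun i j h f => by
    have := hη i j h
    positivity
  -- The numerators of `d i j` and `d j i` add up to the radicand.
  have hlen : ∀ i j, IsEdge T i j → ∀ f : V → ℝ, len (fixedInversive η f) s(i, j) =
      √(Real.exp (f i) ^ 2 + Real.exp (f j) ^ 2 +
        2 * Real.exp (f i) * Real.exp (f j) * η s(i, j)) := by
    intro i j h f
    have h0 := hQ i j h f
    simp only [len, Sym2.lift_mk, fixedInversive, hsq]
    rw [Sym2.eq_swap (a := j) (b := i), add_comm (Real.exp (f j) ^ 2), mul_right_comm 2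
      (Real.exp (f j)), ← add_div, div_eq_iff (Real.sqrt_pos.2 h0).ne', Real.mul_self_sqrt h0.le]
    ring
  refine ⟨fun f hf => (hU f hf).piecewiseFlat, fun i f => (Real.exp_pos _).le,
    fun f hf i j h => ?_, fun f hf i j h => ?_⟩
  · rw [hlen i j h, Real.sq_sqrt (hQ i j h f).le, hsq, hsq]
    have := hη i j h
    have : 0 ≤ 2 * Real.exp (f i) * Real.exp (f j) * η s(i, j) := by positivity
    linarith
  · have h0 := hQ i j h f
    have di := ((ContinuousLinearMap.proj (R := ℝ) (φ := fun _ : V => ℝ) i).hasFDerivAt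
      (x := f)).exp
    have dj := ((ContinuousLinearMap.proj (R := ℝ) (φ := fun _ : V => ℝ) j).hasFDerivAt
      (x := f)).exp
    have hd := (((di.pow 2).add (dj.pow 2)).add
      (((di.const_mul 2).mul dj).mul_const (η s(i, j)))).sqrt h0.ne'
    simp only [hlen i j h]
    refine hd.congr_fderiv ?_
    ext v
    rw [Real.sq_sqrt h0.le, hsq, hsq]
    have := Real.sqrt_pos.2 h0
    simp
    field_simp
    ring

end PiecewiseFlat

end

theorem mainTheorem8 {V : Type*} [Fintype V] (T : AbstractSimplicialComplex V)
    {M : Type*} [TopologicalSpace M] [T2Space M] [CompactSpace M]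
    [ChartedSpace (EuclideanSpace ℝ (Fin 2)) M] (hT : PiecewiseFlat.Triangulates T M) :
    (∀ η : Sym2 V → ℝ, (∀ i j, PiecewiseFlat.IsEdge T i j → 0 ≤ η s(i, j)) →
      ∀ U : Set (V → ℝ), IsOpen U →
        (∀ f ∈ U, PiecewiseFlat.IsMetric T (PiecewiseFlat.fixedInversive η f)) →
        (IsSimplyConnected U →
          ∃ F, PiecewiseFlat.IsCurvatureFunctional T (PiecewiseFlat.fixedInversive η) U F) ∧
        ∀ F, PiecewiseFlat.IsCurvatureFunctional T (PiecewiseFlat.fixedInversive η) U F →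
          ∀ S ⊆ U, Convex ℝ S → ConvexOn ℝ S F) ∧
    (∀ L : Sym2 V → ℝ, PiecewiseFlat.IsPiecewiseFlat T L →
      ∀ U : Set (V → ℝ), IsOpen U →
        (∀ f ∈ U, PiecewiseFlat.IsMetric T (PiecewiseFlat.perpBisector L f)) →
        (IsSimplyConnected U →
          ∃ F, PiecewiseFlat.IsCurvatureFunctional T (PiecewiseFlat.perpBisector L) U F) ∧
        ∀ F, PiecewiseFlat.IsCurvatureFunctional T (PiecewiseFlat.perpBisector L) U F →
          ∀ S ⊆ U, Convex ℝ S → ConvexOn ℝ S F) := by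
  refine ⟨fun η hη U hU hm => ?_, fun L _ U hU hm => ?_⟩
  · have hC := PiecewiseFlat.isConformalOn_fixedInversive hη hm
    exact ⟨hC.exists_isCurvatureFunctional hU, fun F hF S hSU hS => hC.convexOn hU hF hSU hS⟩
  · have hC := PiecewiseFlat.isConformalOn_perpBisector hm
    exact ⟨hC.exists_isCurvatureFunctional hU, fun F hF S hSU hS => hC.convexOn hU hF hSU hS⟩
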